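/- Let $H$ be a finite graph (loops and multiple edges are allowed), $n=|V(H)|$, and let $\Delta(H)=\mathrm{Deg}-\mathrm{Adj}$ be its Kirchhoff Laplacian, where $\mathrm{Deg}$ is the diagonal matrix of vertex degrees and $\mathrm{Adj}$ is the adjacency matrix (off the diagonal it counts the edges joining two vertices; a loop contributes $2$ to the degree and $2$ to the diagonal entry of $\mathrm{Adj}$ at its vertex). Let $C(V(H))$ be the cone on the vertex set of $H$: its vertices are those of $H$ together with a new vertex $W$, and its edges are one edge $PW$ for each vertex $P$ of $H$. Let $C'(H)=H\cup C(V(H))$ be the graph with vertex set $V(H)\sqcup\{W\}$ and edge set $E(H)\sqcup\{PW : P\in V(H)\}$. For a subgraph $G_0$ of a graph $G$, let $ST_j(G,G_0)$ be the number of spanning trees $T$ of $G$ with $|E(T)\cap(E(G)\setminus E(G_0))|=j$. A rooted spanning forest of $H$ is a subgraph of $H$ with vertex set $V(H)$ that is a disjoint union of trees, together with a choice of one vertex (root) in each of these trees. Then $$\det(T\cdot \mathrm{Id}-\Delta(H)) = T^{n}+\sum_{j=1}^{n-1}(-1)^j\, b_j(H)\,T^{n-j},\qquad b_j(H)=ST_j\bigl(C'(H),C(V(H))\bigr).$$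 Moreover, for every $0\le j\le n$, the coefficient of $T^{n-j}$ in $\det(T\cdot \mathrm{Id}-\Delta(H))$ is $(-1)^j b_j(H)$, where $$\begin{aligned} b_j(H) &= ST_j\bigl(C'(H),C(V(H))\bigr)\\ &= \#\{\text{spanning trees } T \text{ of } C'(H) \text{ with } |E(T)\cap E(C(V(H)))| = n-j\}\\ &= \#\{\text{spanning trees } T \text{ of } C'(H) \text{ with } |E(T)\cap E(H)| = j\}\\ &= \#\{\text{rooted spanning forests of } H \text{ with exactly } n-j \text{ components}\}.\end{aligned}$$ -/

import Mathlib

open scoped Graph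

namespace Graph

/-- `G.IsWalk u p v`: the list `p` of pairs (edge traversed, vertex reached) is a walk in the
multigraph `G` from the vertex `u` to the vertex `v`. -/
inductive IsWalk {α β : Type*} (G : Graph α β) : α → List (β × α) → α → Prop
  | nil {u : α} (hu : u ∈ V(G)) : G.IsWalk u [] u
  | cons {u v w : α} {e : β} {p : List (β × α)} (h : G.IsLink e u w) (hp : G.IsWalk w p v) :
      G.IsWalk u ((e, w) :: p) v

/-- A simple path from `u` to `v`: a walk whose vertices are pairwise distinct. Since a path records
its edges, paths that run through different parallel edges are different. -/
def IsSimplePath {α β : Type*} (G : Graph α β) (u : α) (p : List (β × α)) (v : α) : Prop :=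
  G.IsWalk u p v ∧ (u :: p.map Prod.snd).Nodup

/-- A tree: a nonempty multigraph without loops in which any two distinct vertices are connected by
one and only one simple path. -/
structure IsTree {α β : Type*} (G : Graph α β) : Prop where
  nonempty : V(G).Nonempty
  loopless : ∀ e x, ¬ G.IsLoopAt e x
  existsUnique_path : ∀ u ∈ V(G), ∀ v ∈ V(G), u ≠ v → ∃! p, G.IsSimplePath u p v

/-- A spanning tree of `G`: a subgraph of `G` which is a tree and contains all vertices of `G`. -/
def IsSpanningTree {α β : Type*} (G T : Graph α β) : Prop :=
  T ≤ G ∧ V(T) = V(G) ∧ T.IsTree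

/-- The vertex sets of the connected components of `G`. -/
def componentSets {α β : Type*} (G : Graph α β) : Set (Set α) :=
  {C | ∃ u ∈ V(G), C = {v | Relation.ReflTransGen G.Adj u v}}

/-- A forest: a disjoint union of trees, i.e. each connected component is a tree. -/
def IsForest {α β : Type*} (G : Graph α β) : Prop :=
  ∀ C ∈ G.componentSets, (G.induce C).IsTree

/-- A rooted spanning forest of `H`: a subgraph `F` which is a forest and contains all vertices
of `H`, with a choice of one vertex in each component of `F`. The choice is recorded by the set `R`
of chosen vertices (the roots). -/
structure IsRootedSpanningForest {α β : Type*} (H F : Graph α β) (R : Set α) : Prop where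
  le : F ≤ H
  vertexSet_eq : V(F) = V(H)
  isForest : F.IsForest
  roots_subset : R ⊆ V(H)
  existsUnique_root : ∀ C ∈ F.componentSets, ∃! r, r ∈ C ∧ r ∈ R

/-- The number of rooted spanning forests of `H` with exactly `k` components. -/
noncomputable def numRootedSpanningForests {α β : Type*} (H : Graph α β) (k : ℕ) : ℕ :=
  {p : Graph α β × Set α |
    H.IsRootedSpanningForest p.1 p.2 ∧ p.1.componentSets.ncard = k}.ncard

/-- `ST_j(G, G₀)`, for a subgraph `G₀` of `G`: the number of spanning trees of `G` which contain
precisely `j` edges of `E(G) \ E(G₀)`. -/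
noncomputable def numSpanningTrees {α β : Type*} (G G₀ : Graph α β) (j : ℕ) : ℕ :=
  {T : Graph α β | G.IsSpanningTree T ∧ (E(T) ∩ (E(G) \ E(G₀))).ncard = j}.ncard

/-- The cone on a set `V` of vertices: the cone point is `none`, and each `P ∈ V` is joined to it by
exactly one edge, `Sum.inr P`. -/
def cone {α : Type*} (β : Type*) (V : Set α) : Graph (Option α) (β ⊕ α) where
  vertexSet := insert none (some '' V)
  IsLink e x y := ∃ P ∈ V, e = Sum.inr P ∧ ((x = some P ∧ y = none) ∨ (x = none ∧ y = some P))
  isLink_symm := by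
    intro e _
    refine ⟨?_⟩
    rintro x y ⟨P, hP, rfl, h⟩
    exact ⟨P, hP, rfl, by tauto⟩
  eq_or_eq_of_isLink_of_isLink := by
    rintro e x y v w ⟨P, -, rfl, h⟩ ⟨Q, -, hPQ, h'⟩
    obtain rfl : P = Q := by simpa using hPQ
    rcases h with ⟨rfl, rfl⟩ | ⟨rfl, rfl⟩ <;> rcases h' with ⟨rfl, rfl⟩ | ⟨rfl, rfl⟩ <;> simp
  left_mem_of_isLink := by
    rintro e x y ⟨P, hP, rfl, ⟨rfl, rfl⟩ | ⟨rfl, rfl⟩⟩ <;> simp [hP]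

/-- The graph `H` with the cone on its vertices added, `C'(H) = H ∪ C(V(H))`: the vertices `P` and
the edges `e` of `H` appear in it as `some P` and `Sum.inl e`. -/
def addCone {α β : Type*} (H : Graph α β) : Graph (Option α) (β ⊕ α) where
  vertexSet := insert none (some '' V(H))
  IsLink e x y := (∃ f u v, H.IsLink f u v ∧ e = Sum.inl f ∧ x = some u ∧ y = some v) ∨
    (cone β V(H)).IsLink e x y
  isLink_symm := by
    intro e _
    refine ⟨?_⟩
    rintro x y (⟨f, u, v, h, rfl, rfl, rfl⟩ | h)
    · exact Or.inl ⟨f, v, u, h.symm, rfl, rfl, rfl⟩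
    · exact Or.inr h.symm
  eq_or_eq_of_isLink_of_isLink := by
    rintro e x y v w (⟨f, a, b, h, rfl, rfl, rfl⟩ | h) (⟨f', a', b', h', hf, rfl, rfl⟩ | h')
    · obtain rfl : f = f' := by simpa using hf
      simpa using h.left_eq_or_eq h'
    · obtain ⟨P, -, hP, -⟩ := h'
      simp at hP
    · obtain ⟨P, -, hP, -⟩ := h
      simp [hf] at hP
    · exact h.left_eq_or_eq h'
  left_mem_of_isLink := by
    rintro e x y (⟨f, u, v, h, rfl, rfl, rfl⟩ | h)
    · simp [h.left_mem]
    · exact h.left_mem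

/-- The number of edge ends at `x`; a loop at `x` has both its ends there. -/
noncomputable def degree {α β : Type*} (H : Graph α β) (x : α) : ℕ :=
  {e | H.IsNonloopAt e x}.ncard + 2 * {e | H.IsLoopAt e x}.ncard

/-- The adjacency matrix of a multigraph: off the diagonal, the number of edges that join the two
vertices; on the diagonal, twice the number of loops, as a loop contributes two to the degree. -/
noncomputable def adjMatrix {α β : Type*} (H : Graph α β) [DecidableEq V(H)] :
    Matrix V(H) V(H) ℤ :=
  Matrix.of fun x y ↦
    if x = y then 2 * ({e | H.IsLoopAt e x}.ncard : ℤ) else ({e | H.IsLink e x y}.ncard : ℤ)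

/-- The Kirchhoff Laplacian `Δ(H) = Deg - Adj`. -/
noncomputable def laplacian {α β : Type*} (H : Graph α β) [DecidableEq V(H)] :
    Matrix V(H) V(H) ℤ :=
  Matrix.diagonal (fun x : V(H) ↦ (H.degree x : ℤ)) - H.adjMatrix

end Graph

/-! Orient the edges of `H` and let `B` be the oriented incidence matrix. Then `Δ(H) = B Bᵀ`; loops
give zero columns. Hence `T·Id - Δ(H) = [-B | T·Id] [B | Id]ᵀ`, and `[B | Id]` is the incidence
matrix of `C'(H)` with the row of the cone point `W` deleted. By Cauchy-Binet, the determinant is a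
sum over sets `S` of `n` edges of `C'(H)`; each `S` contributes the square of its minor of `[B |
Id]`, times `-1` per edge of `H` and `T` per cone edge (`charpoly_laplacian`). The square is `1` if
`S` connects all `n + 1` vertices and `0` otherwise (`sq_det_coneIncMatrix`), and a connected graph
with `n + 1` vertices and `n` edges is a tree (`isTree_iff_preconn_and_ncard`). So the coefficient
of `T^(n-j)` counts, up to `(-1)^j`, the spanning trees with `j` edges in `H`.

Removing `W` from such a tree leaves a forest in `H`, rooted at the former neighbours of `W`, and
this is reversible (`isRootedSpanningForest_iff_isTree`). If `n > 0` there is at least one root, so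
the term `j = n` vanishes.

Unique simple paths are awkward to move between graphs. They are traded for the condition that each
edge is the only one crossing some vertex cut (`HasEdgeCuts`): a tree is a nonempty connected graph
with such cuts, a forest is any graph with them. -/

namespace Graph

/-- Any two vertices are connected. -/
def Preconn {α β : Type*} (G : Graph α β) : Prop :=
  ∀ u ∈ V(G), ∀ v ∈ V(G), Relation.ReflTransGen G.Adj u v

/-- Every edge is a bridge: it is the only edge that crosses the boundary of a suitable set of
vertices. -/
def HasEdgeCuts {α β : Type*} (G : Graph α β) : Prop :=
  ∀ e ∈ E(G), ∃ A : Set α, ∀ f x y, G.IsLink f x y → ((x ∈ A ↔ y ∈ A) ↔ f ≠ e)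

/-! ### Trees and forests in terms of connectedness and cuts -/

section Paths

variable {α β : Type*} {G G' : Graph α β} {u v w z : α} {e f : β} {p q : List (β × α)}

theorem IsWalk.reflTransGen (h : G.IsWalk u p v) : Relation.ReflTransGen G.Adj u v := by
  induction h with
  | nil => rfl
  | cons h _ ih => exact ih.head ⟨_, h⟩

theorem IsWalk.mono (hG : G ≤ G') (h : G.IsWalk u p v) : G'.IsWalk u p v := by
  induction h with
  | nil hu => exact .nil (hG.vertexSet_mono hu)
  | cons h _ ih => exact .cons (h.mono hG) ih

theorem IsWalk.end_mem (h : G.IsWalk u p v) : v ∈ u :: p.map Prod.snd := by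
  induction h with
  | nil => simp
  | cons h _ ih => simp only [List.map_cons]; exact List.mem_cons_of_mem _ ih

theorem IsWalk.mem_of_inc (h : G.IsWalk w p v) (he : (e, z) ∈ p) (hu : G.Inc e u) :
    u ∈ w :: p.map Prod.snd := by
  induction h with
  | nil => simp at he
  | @cons a b c g p h hp ih =>
    rw [List.mem_cons] at he
    rcases he with he | he
    · obtain ⟨rfl, rfl⟩ := Prod.mk.inj he
      rcases hu.eq_or_eq_of_isLink h with rfl | rfl <;> simp
    · exact List.mem_cons_of_mem _ (ih he)

theorem IsWalk.mem_iff {A : Set α} (h : G.IsWalk u p v)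
    (hA : ∀ f x y, (∃ z, (f, z) ∈ p) → G.IsLink f x y → (x ∈ A ↔ y ∈ A)) : u ∈ A ↔ v ∈ A := by
  induction h with
  | nil => rfl
  | cons h _ ih =>
    refine (hA _ _ _ ⟨_, List.mem_cons_self⟩ h).trans (ih ?_)
    rintro f x y ⟨z, hz⟩
    exact hA f x y ⟨z, List.mem_cons_of_mem _ hz⟩

theorem isSimplePath_cons_iff : G.IsSimplePath u ((e, w) :: p) v ↔
    G.IsLink e u w ∧ u ∉ w :: p.map Prod.snd ∧ G.IsSimplePath w p v := by
  constructor
  · rintro ⟨h, hn⟩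
    cases h with
    | cons h hp =>
      rw [List.map_cons, List.nodup_cons] at hn
      exact ⟨h, hn.1, hp, hn.2⟩
  · rintro ⟨h, hn, hp, hn'⟩
    exact ⟨.cons h hp, by rw [List.map_cons, List.nodup_cons]; exact ⟨hn, hn'⟩⟩

theorem IsSimplePath.mono (hG : G ≤ G') (h : G.IsSimplePath u p v) : G'.IsSimplePath u p v :=
  ⟨h.1.mono hG, h.2⟩

theorem IsSimplePath.exists_suffix (h : G.IsSimplePath w p v) (hu : u ∈ w :: p.map Prod.snd) :
    ∃ q, G.IsSimplePath u q v := by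
  induction p generalizing w with
  | nil =>
    simp only [List.map_nil, List.mem_singleton] at hu
    exact ⟨[], hu ▸ h⟩
  | cons x p ih =>
    obtain ⟨e, y⟩ := x
    rw [List.mem_cons] at hu
    rcases hu with rfl | hu
    · exact ⟨_, h⟩
    · exact ih (isSimplePath_cons_iff.1 h).2.2 hu

theorem exists_isSimplePath (hv : v ∈ V(G)) (h : Relation.ReflTransGen G.Adj u v) :
    ∃ p, G.IsSimplePath u p v := by
  induction h using Relation.ReflTransGen.head_induction_on with
  | refl => exact ⟨[], .nil hv, by simp⟩
  | @head a b hab _ ih =>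
    obtain ⟨p, hp⟩ := ih
    obtain ⟨e, he⟩ := hab
    by_cases ha : a ∈ b :: p.map Prod.snd
    · exact hp.exists_suffix ha
    · exact ⟨(e, b) :: p, isSimplePath_cons_iff.2 ⟨he, ha, hp⟩⟩

/-- Suppose the paths leave `u` by different edges `e` and `f`. Both remainders avoid `u`, hence
avoid `e`, so neither they nor `f` cross the cut of `e`; but `e` must cross it. -/
theorem HasEdgeCuts.isSimplePath_unique (hG : G.HasEdgeCuts) (hp : G.IsSimplePath u p v)
    (hq : G.IsSimplePath u q v) : p = q := by
  induction p generalizing u q with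
  | nil =>
    obtain rfl : v = u := by simpa using hp.1.end_mem
    cases q with
    | nil => rfl
    | cons x q =>
      obtain ⟨f, y⟩ := x
      rw [isSimplePath_cons_iff] at hq
      exact absurd hq.2.2.1.end_mem hq.2.1
  | cons x p ih =>
    obtain ⟨e, w⟩ := x
    rw [isSimplePath_cons_iff] at hp
    obtain ⟨he, hup, hp⟩ := hp
    cases q with
    | nil =>
      obtain rfl : v = u := by simpa using hq.1.end_mem
      exact absurd hp.1.end_mem hup
    | cons x q =>
      obtain ⟨f, y⟩ := x
      rw [isSimplePath_cons_iff] at hq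
      obtain ⟨hf, huq, hq⟩ := hq
      obtain ⟨A, hA⟩ := hG e he.edge_mem
      have avoid {x : α} {r : List (β × α)} (hr : G.IsWalk x r v)
          (hu : u ∉ x :: r.map Prod.snd) : x ∈ A ↔ v ∈ A := by
        refine hr.mem_iff ?_
        rintro g a b ⟨z, hz⟩ hg
        refine (hA _ _ _ hg).2 ?_
        rintro rfl
        exact hu (hr.mem_of_inc hz he.inc_left)
      obtain rfl : f = e := by
        by_contra hne
        have h1 := (hA _ _ _ hf).2 hne
        have h2 := hA _ _ _ he
        have h3 := avoid hp.1 hup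
        have h4 := avoid hq.1 huq
        simp only [ne_eq, not_true, iff_false] at h2
        tauto
      obtain rfl := he.right_unique hf
      rw [ih hp hq]

theorem IsTree.preconn (h : G.IsTree) : G.Preconn := by
  intro u hu v hv
  by_cases huv : u = v
  · rw [huv]
  · exact (h.existsUnique_path u hu v hv huv).exists.choose_spec.1.reflTransGen

theorem IsTree.hasEdgeCuts (h : G.IsTree) : G.HasEdgeCuts := by
  intro e he
  obtain ⟨a, b, hab⟩ := exists_isLink_of_mem_edgeSet he
  have hne : a ≠ b := by
    rintro rfl
    exact h.loopless e a hab
  -- The cut is what `a` reaches without `e`. If it contained `b`, there would be a second simple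
  -- path from `a` to `b` besides `e` itself.
  set A : Set α := {x | Relation.ReflTransGen (G.deleteEdges {e}).Adj a x}
  have ha : a ∈ A := Relation.ReflTransGen.refl
  have hb : b ∉ A := by
    intro hb
    obtain ⟨p, hp⟩ := exists_isSimplePath (by simpa using hab.right_mem) hb
    have hq : G.IsSimplePath a [(e, b)] b :=
      ⟨.cons hab (.nil hab.right_mem), by simpa using hne⟩
    have := (h.existsUnique_path a hab.left_mem b hab.right_mem hne).unique
      (hp.mono deleteEdges_le) hq
    subst this
    have := (isSimplePath_cons_iff.1 hp).1
    simp at this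
  refine ⟨A, fun f x y hf ↦ ?_⟩
  by_cases hfe : f = e
  · subst hfe
    rcases hf.eq_and_eq_or_eq_and_eq hab with ⟨rfl, rfl⟩ | ⟨rfl, rfl⟩ <;> simp [ha, hb]
  · have hadj : (G.deleteEdges {e}).Adj x y := ⟨f, by simp [hf, hfe]⟩
    simp only [hfe, ne_eq, not_false_eq_true, iff_true]
    exact ⟨fun h ↦ h.tail hadj, fun h ↦ h.tail hadj.symm⟩

theorem isTree_iff : G.IsTree ↔ V(G).Nonempty ∧ G.HasEdgeCuts ∧ G.Preconn := by
  refine ⟨fun h ↦ ⟨h.nonempty, h.hasEdgeCuts, h.preconn⟩, fun ⟨hV, hc, hp⟩ ↦ ⟨hV, ?_, ?_⟩⟩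
  · intro e x hx
    obtain ⟨A, hA⟩ := hc e hx.edge_mem
    simpa using hA e x x hx
  · intro u hu v hv _
    obtain ⟨p, hpv⟩ := exists_isSimplePath hv (hp u hu v hv)
    exact ⟨p, hpv, fun q hq ↦ hc.isSimplePath_unique hq hpv⟩

theorem reflTransGen_adj_symm (h : Relation.ReflTransGen G.Adj u v) :
    Relation.ReflTransGen G.Adj v u := by
  induction h with
  | refl => rfl
  | tail _ h ih => exact ih.head h.symm

theorem mem_iff_of_reflTransGen {A : Set α} (hA : ∀ x y, G.Adj x y → x ∈ A → y ∈ A)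
    (h : Relation.ReflTransGen G.Adj u v) (hu : u ∈ A) : v ∈ A := by
  induction h with
  | refl => exact hu
  | tail _ h ih => exact hA _ _ h ih

theorem mem_vertexSet_of_reflTransGen (h : Relation.ReflTransGen G.Adj u v) (hu : u ∈ V(G)) :
    v ∈ V(G) :=
  mem_iff_of_reflTransGen (fun _ _ h _ ↦ h.right_mem) h hu

/-- Cuts are local: a cut inside one component, intersected with that component, is a cut of the
whole graph, and a cut of the whole graph works in each component. -/
theorem isForest_iff : G.IsForest ↔ G.HasEdgeCuts := by
  constructor
  · intro h e he
    obtain ⟨a, b, hab⟩ := exists_isLink_of_mem_edgeSet he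
    set C : Set α := {v | Relation.ReflTransGen G.Adj a v} with hC
    have hstep {f x y} (hf : G.IsLink f x y) : x ∈ C → y ∈ C := fun hx ↦ hx.tail ⟨f, hf⟩
    have ha : a ∈ C := Relation.ReflTransGen.refl
    obtain ⟨A, hA⟩ := (h C ⟨a, hab.left_mem, rfl⟩).hasEdgeCuts e
      (IsLink.edge_mem (x := a) (y := b) (by simp [hab, ha, hstep hab ha]))
    refine ⟨A ∩ C, fun f x y hf ↦ ?_⟩
    by_cases hx : x ∈ C
    · have hy := hstep hf hx
      simpa [hx, hy] using hA f x y (by simp [hf, hx, hy])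
    · have hy : y ∉ C := fun hy ↦ hx (hstep hf.symm hy)
      simp only [Set.mem_inter_iff, hx, hy, and_false, true_iff]
      rintro rfl
      rcases hab.left_eq_or_eq hf with rfl | rfl <;> contradiction
  · rintro h C ⟨u, hu, rfl⟩
    set C : Set α := {v | Relation.ReflTransGen G.Adj u v}
    rw [isTree_iff]
    refine ⟨⟨u, Relation.ReflTransGen.refl⟩, ?_, ?_⟩
    · intro e he
      obtain ⟨x, y, hxy⟩ := exists_isLink_of_mem_edgeSet he
      simp only [induce_isLink] at hxy
      obtain ⟨A, hA⟩ := h e hxy.1.edge_mem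
      refine ⟨A, fun f x y hf ↦ hA f x y ?_⟩
      simp only [induce_isLink] at hf
      exact hf.1
    · have key : ∀ v ∈ C, Relation.ReflTransGen (G.induce C).Adj u v := by
        intro v hv
        change Relation.ReflTransGen G.Adj u v at hv
        induction hv with
        | refl => rfl
        | @tail b c hb hbc ih =>
          obtain ⟨e, he⟩ := hbc
          exact ih.tail ⟨e, by simpa [he] using ⟨hb, hb.tail ⟨e, he⟩⟩⟩
      intro v hv w hw
      exact (reflTransGen_adj_symm (key v hv)).trans (key w hw)

end Paths

/-! ### Numbers of vertices and edges, by linear algebra over `ℚ` -/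

section Counting

variable {α β : Type*} {G : Graph α β}

/-- A function on the vertices of a connected graph is determined by its differences along the edges
and its value at one vertex, so `ℚ^V` embeds in `ℚ^E × ℚ`. -/
theorem Preconn.ncard_vertexSet_le (h : G.Preconn) (hV : V(G).Finite) (hE : E(G).Finite) :
    V(G).ncard ≤ E(G).ncard + 1 := by
  rcases V(G).eq_empty_or_nonempty with h0 | ⟨r, hr⟩
  · simp [h0]
  have := hV.fintype
  have := hE.fintype
  choose a b hab using fun e : E(G) ↦ exists_isLink_of_mem_edgeSet e.2
  let φ : (V(G) → ℚ) →ₗ[ℚ] (E(G) → ℚ) × ℚ :=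
    { toFun := fun x ↦
        (fun e ↦ x ⟨a e, (hab e).left_mem⟩ - x ⟨b e, (hab e).right_mem⟩, x ⟨r, hr⟩)
      map_add' := fun x y ↦ by ext <;> simp; ring
      map_smul' := fun c x ↦ by ext <;> simp; ring }
  have hφ : Function.Injective φ := by
    rw [← LinearMap.ker_eq_bot, LinearMap.ker_eq_bot']
    intro x hx
    have h1 (e : E(G)) := congrFun (congrArg Prod.fst hx) e
    have h2 : x ⟨r, hr⟩ = 0 := congrArg Prod.snd hx
    simp only [φ, LinearMap.coe_mk, AddHom.coe_mk, Prod.fst_zero, Pi.zero_apply, sub_eq_zero] at h1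
    ext ⟨v, hv⟩
    have := mem_iff_of_reflTransGen (A := {v | ∃ hv : v ∈ V(G), x ⟨v, hv⟩ = 0}) ?_ (h r hr v hv)
      ⟨hr, h2⟩
    · exact this.2
    · rintro y z ⟨e, he⟩ ⟨hy, hxy⟩
      refine ⟨he.right_mem, ?_⟩
      have := h1 ⟨e, he.edge_mem⟩
      rcases he.eq_and_eq_or_eq_and_eq (hab ⟨e, he.edge_mem⟩) with ⟨h3, h4⟩ | ⟨h3, h4⟩
      · simp only [← h3, ← h4] at this
        rw [← this, hxy]
      · simp only [← h3, ← h4] at this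
        rw [this, hxy]
  simpa [← Nat.card_eq_fintype_card] using LinearMap.finrank_le_finrank_of_injective hφ

/-- The indicators of the cuts and the constant `1` are linearly independent in `ℚ^V`: along an edge
`f`, only the indicator of the cut of `f` jumps. -/
theorem HasEdgeCuts.ncard_edgeSet_lt (h : G.HasEdgeCuts) (hV : V(G).Finite) (hE : E(G).Finite)
    (hne : V(G).Nonempty) : E(G).ncard + 1 ≤ V(G).ncard := by
  classical
  obtain ⟨r, hr⟩ := hne
  have := hV.fintype
  have := hE.fintype
  choose a b hab using fun e : E(G) ↦ exists_isLink_of_mem_edgeSet e.2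
  choose A hA using fun e : E(G) ↦ h e e.2
  let ind (e : E(G)) (v : α) : ℚ := if v ∈ A e then 1 else 0
  have ind_eq (e f : E(G)) (hef : f ≠ e) : ind e (a f) = ind e (b f) := by
    have := (hA e f _ _ (hab f)).2 (fun h ↦ hef (Subtype.ext h))
    simp [ind, this]
  have ind_ne (e : E(G)) : ind e (a e) ≠ ind e (b e) := by
    have := hA e e _ _ (hab e)
    by_cases h1 : a e ∈ A e <;> by_cases h2 : b e ∈ A e <;> simp_all [ind]
  let φ : (E(G) → ℚ) × ℚ →ₗ[ℚ] (V(G) → ℚ) :=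
    { toFun := fun x v ↦ ∑ e, x.1 e * ind e v + x.2
      map_add' := fun x y ↦ by
        ext; simp [add_mul, Finset.sum_add_distrib]; ring
      map_smul' := fun c x ↦ by
        ext; simp [Finset.mul_sum, mul_add, mul_assoc] }
  have hφ : Function.Injective φ := by
    rw [← LinearMap.ker_eq_bot, LinearMap.ker_eq_bot']
    rintro ⟨x, c⟩ hx
    have hx' (v : α) (hv : v ∈ V(G)) : ∑ e, x e * ind e v + c = 0 := congrFun hx ⟨v, hv⟩
    have hx0 : x = 0 := by
      ext f
      have h1 := hx' _ (hab f).left_mem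
      rw [← hx' _ (hab f).right_mem, add_left_inj, ← sub_eq_zero, ← Finset.sum_sub_distrib,
        Finset.sum_eq_single f] at h1
      · rw [← mul_sub] at h1
        exact (mul_eq_zero.1 h1).resolve_right (sub_ne_zero.2 (ind_ne f))
      · intro e _ hef
        rw [ind_eq e f hef.symm, sub_self]
      · simp
    subst hx0
    simpa using hx' r hr
  simpa [← Nat.card_eq_fintype_card] using LinearMap.finrank_le_finrank_of_injective hφ

/-- Deleting any edge leaves too few edges for a connected graph. -/
theorem Preconn.hasEdgeCuts_of_ncard_lt (h : G.Preconn) (hV : V(G).Finite) (hE : E(G).Finite)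
    (hcard : E(G).ncard + 1 ≤ V(G).ncard) : G.HasEdgeCuts := by
  intro e he
  have h1 : ¬ (G.deleteEdges {e}).Preconn := by
    intro h1
    have := h1.ncard_vertexSet_le (by simpa using hV) (hE.subset deleteEdges_le.edgeSet_mono)
    have h2 := Set.ncard_sdiff_singleton_add_one he hE
    simp at this
    omega
  simp only [Preconn, not_forall] at h1
  obtain ⟨u, hu, v, hv, huv⟩ := h1
  set A : Set α := {x | Relation.ReflTransGen (G.deleteEdges {e}).Adj u x}
  have hA {f x y} (hf : G.IsLink f x y) (hfe : f ≠ e) : x ∈ A → y ∈ A :=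
    fun h ↦ h.tail ⟨f, by simp [hf, hfe]⟩
  refine ⟨A, fun f x y hf ↦ ⟨?_, fun hfe ↦ ⟨hA hf hfe, hA hf.symm hfe⟩⟩⟩
  -- If the deleted edge did not cross `A`, then `A` would be closed under adjacency in `G` and
  -- would contain `v`.
  rintro hxy rfl
  refine huv (mem_iff_of_reflTransGen (G := G) (A := A) ?_ (h u (by simpa using hu) v
    (by simpa using hv)) Relation.ReflTransGen.refl)
  rintro a b ⟨g, hg⟩ ha
  by_cases hgf : g = f
  · subst hgf
    rcases hg.eq_and_eq_or_eq_and_eq hf with ⟨rfl, rfl⟩ | ⟨rfl, rfl⟩ <;> tauto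
  · exact hA hg hgf ha

theorem isTree_iff_preconn_and_ncard (hV : V(G).Finite) (hE : E(G).Finite) :
    G.IsTree ↔ G.Preconn ∧ V(G).ncard = E(G).ncard + 1 := by
  rw [isTree_iff]
  constructor
  · rintro ⟨h0, hc, hp⟩
    exact ⟨hp, (hp.ncard_vertexSet_le hV hE).antisymm (hc.ncard_edgeSet_lt hV hE h0)⟩
  · rintro ⟨hp, hcard⟩
    exact ⟨Set.nonempty_of_ncard_ne_zero (by omega), hp.hasEdgeCuts_of_ncard_lt hV hE hcard.ge, hp⟩

end Counting

end Graph

/-! ### The Cauchy-Binet formula -/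

namespace Matrix

open Finset Equiv

variable {n N R : Type*} [Fintype n] [DecidableEq n] [Fintype N] [CommRing R]

theorem det_mul_eq_sum_functions (A : Matrix n N R) (B : Matrix N n R) :
    (A * B).det = ∑ f : n → N, (∏ i, A i (f i)) * (B.submatrix f id).det := by
  have h : A * B = fun i ↦ ∑ k, A i k • B k := by
    ext i j
    simp [Matrix.mul_apply]
  change detRowAlternating (A * B) = _
  rw [h]
  change (detRowAlternating : (n → R) [⋀^n]→ₗ[R] R).toMultilinearMap (fun i ↦ ∑ k, A i k • B k) = _
  rw [MultilinearMap.map_sum]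
  refine sum_congr rfl fun f _ ↦ ?_
  rw [MultilinearMap.map_smul_univ]
  rfl

variable [DecidableEq N] in
/-- The Cauchy-Binet formula; `g S` enumerates the elements of the set `S` of `n` elements. -/
theorem det_mul_eq_sum_powersetCard (A : Matrix n N R) (B : Matrix N n R) (g : Finset N → n → N)
    (hinj : ∀ S ∈ powersetCard (Fintype.card n) univ, Function.Injective (g S))
    (himg : ∀ S ∈ powersetCard (Fintype.card n) univ, univ.image (g S) = S) :
    (A * B).det = ∑ S ∈ powersetCard (Fintype.card n) (univ : Finset N),
      (A.submatrix id (g S)).det * (B.submatrix (g S) id).det := by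
  rw [det_mul_eq_sum_functions]
  -- A non-injective `f` repeats a row of `B`.
  have h1 : ∑ f : n → N, (∏ i, A i (f i)) * (B.submatrix f id).det =
      ∑ f : n → N with Function.Injective f, (∏ i, A i (f i)) * (B.submatrix f id).det := by
    rw [sum_filter_of_ne]
    intro f _ hf
    by_contra hinj
    simp only [Function.Injective, not_forall] at hinj
    obtain ⟨i, j, hij, hne⟩ := hinj
    refine hf ?_
    rw [det_zero_of_row_eq hne (by ext k; simp [hij]), mul_zero]
  rw [h1, ← sum_fiberwise_of_maps_to (g := fun f : n → N ↦ univ.image f)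
    (t := powersetCard (Fintype.card n) (univ : Finset N))]
  · refine sum_congr rfl fun S hS ↦ ?_
    -- The injections with image `S` are exactly the `g S ∘ σ`.
    have hbij : ∑ σ : Perm n, (∏ i, A i (g S (σ i))) * (B.submatrix (g S ∘ σ) id).det =
        ∑ f ∈ {f ∈ {f : n → N | Function.Injective f} | univ.image f = S},
          (∏ i, A i (f i)) * (B.submatrix f id).det := by
      refine sum_bij (fun σ _ ↦ g S ∘ σ) ?_ ?_ ?_ ?_
      · intro σ _
        simp only [mem_filter, mem_univ, true_and]
        refine ⟨(hinj S hS).comp σ.injective, ?_⟩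
        rw [← image_image, image_univ_equiv, himg S hS]
      · intro σ _ τ _ h
        ext i
        exact hinj S hS (congrFun h i)
      · intro f hf
        simp only [mem_filter, mem_univ, true_and] at hf
        have hex (i : n) : ∃ j, g S j = f i := by
          have : f i ∈ univ.image (g S) := by
            rw [himg S hS, ← hf.2]
            exact mem_image_of_mem _ (mem_univ i)
          simpa using this
        choose σ hσ using hex
        have hσi : Function.Injective σ := by
          intro i j hij
          apply hf.1
          rw [← hσ i, ← hσ j, hij]
        exact ⟨Equiv.ofBijective σ (Finite.injective_iff_bijective.1 hσi), mem_univ _, funext hσ⟩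
      · intro σ _
        rfl
    -- Undoing `σ` in the minor of `B` produces `sign σ`, which completes the Leibniz expansion of
    -- the minor of `A`.
    rw [← hbij, ← det_transpose, det_apply', sum_mul]
    refine sum_congr rfl fun σ _ ↦ ?_
    have : B.submatrix (g S ∘ σ) id = (B.submatrix (g S) id).submatrix σ id := rfl
    rw [this, det_permute]
    simp only [transpose_apply, submatrix_apply, id_eq]
    ring
  · intro f hf
    simp only [mem_filter, mem_univ, true_and] at hf
    rw [mem_powersetCard_univ, card_image_of_injective _ hf, card_univ]

end Matrix

namespace Graph

/-! ### Spanning trees as edge sets -/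

section Restrict

variable {α β : Type*} {G : Graph α β}

theorem eq_restrict_of_isSpanningTree {T : Graph α β} (h : G.IsSpanningTree T) :
    T = G.restrict E(T) := by
  refine Graph.ext h.2.1 fun e x y ↦ ?_
  rw [restrict_isLink]
  refine ⟨fun he ↦ ?_, fun he ↦ ?_⟩
  · have h1 := he.mono h.1
    have h2 := he.edge_mem
    tauto
  · exact (h.1.isLink_iff (by tauto)).2 (by tauto)

theorem isSpanningTree_restrict_iff {S : Set β} :
    G.IsSpanningTree (G.restrict S) ↔ (G.restrict S).IsTree :=
  ⟨fun h ↦ h.2.2, fun h ↦ ⟨restrict_le, rfl, h⟩⟩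

/-- Counting spanning trees is counting their edge sets. -/
theorem ncard_isSpanningTree (P : Set β → Prop) :
    {T | G.IsSpanningTree T ∧ P E(T)}.ncard =
      {S | S ⊆ E(G) ∧ (G.restrict S).IsTree ∧ P S}.ncard := by
  refine Set.ncard_congr (fun T _ ↦ E(T)) ?_ ?_ ?_
  · rintro T ⟨hT, hP⟩
    refine ⟨hT.1.edgeSet_mono, ?_, hP⟩
    rw [← eq_restrict_of_isSpanningTree hT]
    exact hT.2.2
  · rintro T T' ⟨hT, -⟩ ⟨hT', -⟩ h
    rw [eq_restrict_of_isSpanningTree hT, eq_restrict_of_isSpanningTree hT', h]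
  · rintro S ⟨hS, hT, hP⟩
    have hE : E(G.restrict S) = S := by simpa using hS
    refine ⟨G.restrict S, ⟨isSpanningTree_restrict_iff.2 hT, ?_⟩, hE⟩
    rwa [hE]

end Restrict

/-! ### Components counted by their roots -/

section Components

variable {α β : Type*} {F : Graph α β} {R : Set α}

theorem ncard_componentSets (hR : R ⊆ V(F)) (h : ∀ C ∈ F.componentSets, ∃! r, r ∈ C ∧ r ∈ R) :
    F.componentSets.ncard = R.ncard := by
  symm
  refine Set.ncard_congr (fun r _ ↦ {v | Relation.ReflTransGen F.Adj r v}) ?_ ?_ ?_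
  · exact fun r hr ↦ ⟨r, hR hr, rfl⟩
  · intro r s hr hs hrs
    refine (h _ ⟨r, hR hr, rfl⟩).unique ⟨Relation.ReflTransGen.refl, hr⟩ ⟨?_, hs⟩
    rw [hrs]
    exact Relation.ReflTransGen.refl
  · rintro C ⟨u, hu, rfl⟩
    obtain ⟨r, hur, hr⟩ := (h _ ⟨u, hu, rfl⟩).exists
    refine ⟨r, hr, Set.ext fun v ↦ ⟨fun h ↦ Relation.ReflTransGen.trans hur h, fun h ↦ ?_⟩⟩
    exact (reflTransGen_adj_symm hur).trans h

end Components

/-! ### Spanning trees of the cone graph and rooted spanning forests -/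

section Cone

variable {α β : Type*} {H : Graph α β} {x y : Option α}

theorem vertexSet_addCone : V(H.addCone) = insert none (some '' V(H)) := rfl

theorem addCone_isLink_inl {f : β} : H.addCone.IsLink (.inl f) x y ↔
    ∃ u v, H.IsLink f u v ∧ x = some u ∧ y = some v := by
  simp [addCone, cone]

theorem addCone_isLink_inl_some {f : β} {u v : α} :
    H.addCone.IsLink (.inl f) (some u) (some v) ↔ H.IsLink f u v := by
  simp [addCone_isLink_inl]

theorem addCone_isLink_inr {P : α} : H.addCone.IsLink (.inr P) x y ↔
    P ∈ V(H) ∧ ((x = some P ∧ y = none) ∨ (x = none ∧ y = some P)) := by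
  simp [addCone, cone]

theorem edgeSet_cone (V : Set α) : E(cone β V) = Sum.inr '' V := by
  ext e
  rw [edge_mem_iff_exists_isLink]
  constructor
  · rintro ⟨x, y, P, hP, rfl, -⟩
    exact ⟨P, hP, rfl⟩
  · rintro ⟨P, hP, rfl⟩
    exact ⟨some P, none, P, hP, rfl, Or.inl ⟨rfl, rfl⟩⟩

theorem edgeSet_addCone : E(H.addCone) = Sum.inl '' E(H) ∪ Sum.inr '' V(H) := by
  ext e
  rw [edge_mem_iff_exists_isLink]
  rcases e with e | P
  · simp only [addCone_isLink_inl, Set.mem_union, Set.mem_image, Sum.inl.injEq, exists_eq_right,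
      reduceCtorEq, and_false, exists_false, or_false]
    rw [edge_mem_iff_exists_isLink]
    constructor
    · rintro ⟨_, _, u, v, h, rfl, rfl⟩
      exact ⟨u, v, h⟩
    · rintro ⟨u, v, h⟩
      exact ⟨_, _, u, v, h, rfl, rfl⟩
  · simp only [addCone_isLink_inr, Set.mem_union, Set.mem_image, Sum.inr.injEq, exists_eq_right,
      reduceCtorEq, and_false, exists_false, false_or]
    exact ⟨fun ⟨_, _, h, _⟩ ↦ h, fun h ↦ ⟨_, _, h, Or.inl ⟨rfl, rfl⟩⟩⟩

theorem edgeSet_addCone_sdiff : E(H.addCone) \ E(cone β V(H)) = Sum.inl '' E(H) := by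
  rw [edgeSet_addCone, edgeSet_cone]
  ext (e | P) <;> simp

variable {S : Set (β ⊕ α)}

theorem reflTransGen_addCone_restrict {u v : α}
    (h : Relation.ReflTransGen (H.restrict (Sum.inl ⁻¹' S)).Adj u v) :
    Relation.ReflTransGen (H.addCone.restrict S).Adj (some u) (some v) := by
  refine h.lift some ?_
  rintro a b ⟨e, he⟩
  rw [restrict_isLink] at he
  refine ⟨.inl e, ?_⟩
  rw [restrict_isLink, addCone_isLink_inl_some]
  exact he

/-- A component without a cone edge cannot reach the cone point. With cone edges at `r ≠ s`, the
connection from `r` through `s` to the cone point closes a cycle, so no cut isolates the cone edge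
at `r`. -/
theorem existsUnique_root_of_isTree (h : (H.addCone.restrict S).IsTree) :
    ∀ C ∈ (H.restrict (Sum.inl ⁻¹' S)).componentSets, ∃! r, r ∈ C ∧ r ∈ Sum.inr ⁻¹' S := by
  obtain ⟨-, hc, hp⟩ := isTree_iff.1 h
  rintro C ⟨u, hu, rfl⟩
  refine existsUnique_of_exists_of_unique ?_ ?_
  · by_contra! hno
    have := mem_iff_of_reflTransGen (G := H.addCone.restrict S)
      (A := some '' {v | Relation.ReflTransGen (H.restrict (Sum.inl ⁻¹' S)).Adj u v}) ?_
      (hp (some u) (Or.inr ⟨u, hu, rfl⟩) none (Or.inl rfl)) ⟨u, Relation.ReflTransGen.refl, rfl⟩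
    · simp at this
    · rintro _ y ⟨e | P, he⟩ ⟨v, hv, rfl⟩
      · rw [restrict_isLink, addCone_isLink_inl] at he
        obtain ⟨heS, a, b, hab, ha, rfl⟩ := he
        obtain rfl := Option.some.inj ha
        have h1 : e ∈ Sum.inl ⁻¹' S := by
          simp only [Set.mem_preimage]
          tauto
        exact ⟨b, Relation.ReflTransGen.tail hv ⟨e, by rw [restrict_isLink]; tauto⟩, rfl⟩
      · rw [restrict_isLink, addCone_isLink_inr] at he
        have hP : v = P := by simp at he; tauto
        subst hP
        refine absurd ?_ (hno v hv)
        simp only [Set.mem_preimage]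
        tauto
  · rintro r s ⟨hr, hrS⟩ ⟨hs, hsS⟩
    by_contra hrs
    have hrs' := (reflTransGen_adj_symm hr).trans hs
    have link {t} (ht : Relation.ReflTransGen (H.restrict (Sum.inl ⁻¹' S)).Adj u t)
        (htS : t ∈ Sum.inr ⁻¹' S) : (H.addCone.restrict S).IsLink (.inr t) (some t) none := by
      rw [restrict_isLink, addCone_isLink_inr]
      exact ⟨htS, mem_vertexSet_of_reflTransGen (G := H.restrict (Sum.inl ⁻¹' S)) ht hu, by simp⟩
    obtain ⟨A, hA⟩ := hc _ (link hr hrS).edge_mem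
    have h1 := hA _ _ _ (link hr hrS)
    have h2 := hA _ _ _ (link hs hsS)
    have step {a b} (hab : (H.restrict (Sum.inl ⁻¹' S)).Adj a b) : some a ∈ A ↔ some b ∈ A := by
      obtain ⟨e, he⟩ := hab
      rw [restrict_isLink] at he
      refine (hA (.inl e) (some a) (some b) ?_).2 (by simp)
      rw [restrict_isLink, addCone_isLink_inl_some]
      exact he
    have h3 : some r ∈ A ↔ some s ∈ A := by
      clear h1 h2 hs hsS hrs
      induction hrs' with
      | refl => rfl
      | tail _ hab ih => exact ih.trans (step hab)
    simp only [ne_eq, not_true, iff_false, Sum.inr.injEq, Ne.symm hrs, not_false_eq_true,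
      iff_true] at h1 h2
    tauto

theorem hasEdgeCuts_of_isTree (h : (H.addCone.restrict S).IsTree) :
    (H.restrict (Sum.inl ⁻¹' S)).HasEdgeCuts := by
  intro e he
  have hlink {f u v} (hf : (H.restrict (Sum.inl ⁻¹' S)).IsLink f u v) :
      (H.addCone.restrict S).IsLink (.inl f) (some u) (some v) := by
    rw [restrict_isLink] at hf ⊢
    rw [addCone_isLink_inl_some]
    exact hf
  obtain ⟨x, y, hxy⟩ := exists_isLink_of_mem_edgeSet he
  obtain ⟨A, hA⟩ := h.hasEdgeCuts _ (hlink hxy).edge_mem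
  exact ⟨some ⁻¹' A, fun f u v hf ↦ by simpa using hA _ _ _ (hlink hf)⟩

theorem preconn_of_roots
    (h : ∀ C ∈ (H.restrict (Sum.inl ⁻¹' S)).componentSets, ∃! r, r ∈ C ∧ r ∈ Sum.inr ⁻¹' S) :
    (H.addCone.restrict S).Preconn := by
  have key : ∀ x ∈ V(H.addCone.restrict S),
      Relation.ReflTransGen (H.addCone.restrict S).Adj x none := by
    rintro x (rfl | ⟨u, hu, rfl⟩)
    · rfl
    · obtain ⟨r, hr, hrS⟩ := (h _ ⟨u, hu, rfl⟩).exists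
      refine (reflTransGen_addCone_restrict hr).tail ⟨.inr r, ?_⟩
      rw [restrict_isLink, addCone_isLink_inr]
      exact ⟨hrS, mem_vertexSet_of_reflTransGen (G := H.restrict (Sum.inl ⁻¹' S)) hr hu, by simp⟩
  exact fun x hx y hy ↦ (key x hx).trans (reflTransGen_adj_symm (key y hy))

/-- For an edge of `H`, the rootless side of its cut within its component meets no cone edge. For
the cone edge at `P`, the component of `P` works, since its only root is `P`. -/
theorem hasEdgeCuts_addCone (hc : (H.restrict (Sum.inl ⁻¹' S)).HasEdgeCuts)
    (h : ∀ C ∈ (H.restrict (Sum.inl ⁻¹' S)).componentSets, ∃! r, r ∈ C ∧ r ∈ Sum.inr ⁻¹' S) :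
    (H.addCone.restrict S).HasEdgeCuts := by
  set F := H.restrict (Sum.inl ⁻¹' S) with hF
  rintro (e | P) he
  · obtain ⟨x, y, hxy⟩ := exists_isLink_of_mem_edgeSet he
    rw [restrict_isLink, addCone_isLink_inl] at hxy
    obtain ⟨heS, a, b, hab, rfl, rfl⟩ := hxy
    have heF : F.IsLink e a b := by
      rw [hF, restrict_isLink]
      simp only [Set.mem_preimage]
      tauto
    obtain ⟨r, hr⟩ := h _ ⟨a, hab.left_mem, rfl⟩
    -- the side of the cut in the component of `e` that does not contain the root
    obtain ⟨A, hA, hrA⟩ : ∃ A : Set α, (∀ f x y, F.IsLink f x y → ((x ∈ A ↔ y ∈ A) ↔ f ≠ e)) ∧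
        r ∉ A := by
      obtain ⟨A, hA⟩ := hc e heF.edge_mem
      by_cases hrA : r ∈ A
      · refine ⟨Aᶜ, fun f x y hf ↦ ?_, by simpa using hrA⟩
        rw [← hA f x y hf]
        simp only [Set.mem_compl_iff]
        tauto
      · exact ⟨A, hA, hrA⟩
    refine ⟨some '' (A ∩ {v | Relation.ReflTransGen F.Adj a v}), ?_⟩
    rintro (f | Q) x y hf
    · rw [restrict_isLink, addCone_isLink_inl] at hf
      obtain ⟨hfS, u, v, huv, rfl, rfl⟩ := hf
      have hfF : F.IsLink f u v := by
        rw [hF, restrict_isLink]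
        simp only [Set.mem_preimage]
        tauto
      have hcomp : Relation.ReflTransGen F.Adj a u ↔ Relation.ReflTransGen F.Adj a v :=
        ⟨fun h ↦ h.tail ⟨f, hfF⟩, fun h ↦ h.tail ⟨f, hfF.symm⟩⟩
      simp only [Set.mem_image, Option.some.injEq, exists_eq_right, Set.mem_inter_iff,
        Set.mem_ofPred_eq, ne_eq, Sum.inl.injEq]
      by_cases hu : Relation.ReflTransGen F.Adj a u
      · simpa [hu, hcomp.1 hu] using hA f u v hfF
      · have hne : f ≠ e := by
          rintro rfl
          rcases heF.left_eq_or_eq hfF with rfl | rfl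
          · exact hu Relation.ReflTransGen.refl
          · exact hu (hcomp.2 Relation.ReflTransGen.refl)
        simp [hu, mt hcomp.2 hu, hne]
    · rw [restrict_isLink, addCone_isLink_inr] at hf
      have hQ : some Q ∉ some '' (A ∩ {v | Relation.ReflTransGen F.Adj a v}) := by
        rintro ⟨_, ⟨hQA, hQ⟩, h1⟩
        obtain rfl := Option.some.inj h1
        refine hrA (hr.2 _ ⟨hQ, ?_⟩ ▸ hQA)
        simp only [Set.mem_preimage]
        tauto
      have h0 : (none : Option α) ∉ some '' (A ∩ {v | Relation.ReflTransGen F.Adj a v}) := by simp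
      obtain ⟨rfl, rfl⟩ | ⟨rfl, rfl⟩ : (x = some Q ∧ y = none) ∨ (x = none ∧ y = some Q) := by
        tauto
      all_goals simp only [hQ, h0, ne_eq, reduceCtorEq, not_false_eq_true]
  · have hP : P ∈ V(H) ∧ P ∈ Sum.inr ⁻¹' S := by
      rw [edgeSet_restrict, edgeSet_addCone] at he
      simpa using he
    refine ⟨some '' {v | Relation.ReflTransGen F.Adj P v}, ?_⟩
    rintro (f | Q) x y hf
    · rw [restrict_isLink, addCone_isLink_inl] at hf
      obtain ⟨hfS, u, v, huv, rfl, rfl⟩ := hf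
      have hfF : F.IsLink f u v := by
        rw [hF, restrict_isLink]
        simp only [Set.mem_preimage]
        tauto
      simpa using ⟨fun h ↦ h.tail ⟨f, hfF⟩, fun h ↦ h.tail ⟨f, hfF.symm⟩⟩
    · rw [restrict_isLink, addCone_isLink_inr] at hf
      have hQ : some Q ∈ some '' {v | Relation.ReflTransGen F.Adj P v} ↔ Q = P := by
        constructor
        · rintro ⟨_, hQ, h1⟩
          obtain rfl := Option.some.inj h1
          refine (h _ ⟨P, hP.1, rfl⟩).unique ⟨hQ, ?_⟩ ⟨Relation.ReflTransGen.refl, hP.2⟩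
          simp only [Set.mem_preimage]
          tauto
        · rintro rfl
          exact ⟨Q, Relation.ReflTransGen.refl, rfl⟩
      have h0 : (none : Option α) ∉ some '' {v | Relation.ReflTransGen F.Adj P v} := by simp
      obtain ⟨rfl, rfl⟩ | ⟨rfl, rfl⟩ : (x = some Q ∧ y = none) ∨ (x = none ∧ y = some Q) := by
        tauto
      all_goals simp only [hQ, h0, ne_eq, Sum.inr.injEq, iff_false, false_iff]

/-- Rooted spanning forests of `H` correspond to spanning trees of `H.addCone`. -/
theorem isRootedSpanningForest_iff_isTree (hS : S ⊆ E(H.addCone)) :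
    H.IsRootedSpanningForest (H.restrict (Sum.inl ⁻¹' S)) (Sum.inr ⁻¹' S) ↔
      (H.addCone.restrict S).IsTree := by
  constructor
  · intro h
    exact isTree_iff.2 ⟨⟨none, Or.inl rfl⟩,
      hasEdgeCuts_addCone (isForest_iff.1 h.isForest) h.existsUnique_root,
      preconn_of_roots h.existsUnique_root⟩
  · intro h
    refine ⟨restrict_le, rfl, isForest_iff.2 (hasEdgeCuts_of_isTree h), fun P hP ↦ ?_,
      existsUnique_root_of_isTree h⟩
    have := hS hP
    rw [edgeSet_addCone] at this
    simpa using this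

theorem numRootedSpanningForests_eq (k : ℕ) : H.numRootedSpanningForests k =
    {S | S ⊆ E(H.addCone) ∧ (H.addCone.restrict S).IsTree ∧ (Sum.inr ⁻¹' S).ncard = k}.ncard := by
  symm
  refine Set.ncard_congr (fun S _ ↦ (H.restrict (Sum.inl ⁻¹' S), Sum.inr ⁻¹' S)) ?_ ?_ ?_
  · rintro S ⟨hS, hT, hk⟩
    have h := (isRootedSpanningForest_iff_isTree hS).2 hT
    exact ⟨h, (ncard_componentSets (F := H.restrict (Sum.inl ⁻¹' S)) h.roots_subset h.existsUnique_root).trans hk⟩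
  · rintro S S' ⟨hS, -⟩ ⟨hS', -⟩ h
    have h1 : E(H.restrict (Sum.inl ⁻¹' S)) = E(H.restrict (Sum.inl ⁻¹' S')) :=
      congrArg (fun p ↦ E(p.1)) h
    have h2 : (Sum.inr ⁻¹' S : Set α) = Sum.inr ⁻¹' S' := congrArg Prod.snd h
    rw [edgeSet_restrict, edgeSet_restrict] at h1
    rw [edgeSet_addCone] at hS hS'
    ext (e | P)
    · have h3 := Set.ext_iff.1 h1 e
      have h4 := @hS (.inl e)
      have h5 := @hS' (.inl e)
      simp at h3 h4 h5
      tauto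
    · exact Set.ext_iff.1 h2 P
  · rintro ⟨F, R⟩ ⟨h, hk⟩
    have hl : Sum.inl ⁻¹' (Sum.inl '' E(F) ∪ Sum.inr '' R : Set (β ⊕ α)) = E(F) := by
      ext; simp
    have hr : Sum.inr ⁻¹' (Sum.inl '' E(F) ∪ Sum.inr '' R : Set (β ⊕ α)) = R := by
      ext; simp
    have hF : H.restrict E(F) = F := by
      refine Graph.ext h.vertexSet_eq.symm fun e x y ↦ ?_
      rw [restrict_isLink]
      refine ⟨fun he ↦ (h.le.isLink_iff (by tauto)).2 (by tauto), fun he ↦ ?_⟩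
      have h1 := he.mono h.le
      have h2 := he.edge_mem
      tauto
    have hS : (Sum.inl '' E(F) ∪ Sum.inr '' R : Set (β ⊕ α)) ⊆ E(H.addCone) := by
      rw [edgeSet_addCone]
      exact Set.union_subset_union (Set.image_mono h.le.edgeSet_mono)
        (Set.image_mono h.roots_subset)
    refine ⟨Sum.inl '' E(F) ∪ Sum.inr '' R, ⟨hS, ?_, ?_⟩, ?_⟩
    · rw [← isRootedSpanningForest_iff_isTree hS, hl, hr, hF]
      exact h
    · rw [hr, ← hk]
      exact (ncard_componentSets (h.roots_subset.trans h.vertexSet_eq.ge)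
        h.existsUnique_root).symm
    · rw [hl, hr, hF]

end Cone

end Graph

namespace Graph

/-! ### The Laplacian as a product of incidence matrices -/

section Incidence

variable {α β : Type*} {H : Graph α β}

theorem ncard_eq_sum_edgeSet [Fintype E(H)] (P : β → Prop) [DecidablePred fun e : E(H) ↦ P e]
    (hP : ∀ e, P e → e ∈ E(H)) :
    ({e | P e}.ncard : ℤ) = ∑ e : E(H), if P e then 1 else 0 := by
  rw [Finset.sum_boole, ← Set.ncard_coe_finset, ← Set.ncard_image_of_injective _
    (Subtype.val_injective (p := (· ∈ E(H))))]
  congr 2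
  ext e
  simp only [Set.mem_ofPred_eq, Finset.coe_filter, Finset.mem_univ, true_and, Set.mem_image,
    Subtype.exists, exists_and_left, exists_prop, exists_eq_right_right]
  exact ⟨fun h ↦ ⟨h, hP e h⟩, fun h ↦ h.1⟩

variable [DecidableEq V(H)]

/-- The incidence matrix of `H`, where `e` is oriented from `a e` to `b e`. -/
def orientedIncMatrix (a b : E(H) → V(H)) : Matrix V(H) E(H) ℤ :=
  Matrix.of fun v e ↦ (if v = a e then 1 else 0) - (if v = b e then 1 else 0)

/-- The incidence matrix of `H.addCone` without the row of the cone point. -/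
def coneIncMatrix (a b : E(H) → V(H)) : Matrix V(H) (E(H) ⊕ V(H)) ℤ :=
  Matrix.fromCols (orientedIncMatrix a b) 1

theorem laplacian_eq_mul_transpose [Fintype E(H)] (a b : E(H) → V(H))
    (hab : ∀ e : E(H), H.IsLink e (a e) (b e)) :
    H.laplacian = orientedIncMatrix a b * (orientedIncMatrix a b).transpose := by
  classical
  ext x y
  simp only [laplacian, adjMatrix, degree, orientedIncMatrix, Matrix.sub_apply, Matrix.mul_apply,
    Matrix.transpose_apply, Matrix.of_apply]
  by_cases hxy : x = y
  · subst hxy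
    rw [Matrix.diagonal_apply_eq, if_pos rfl]
    push_cast
    rw [add_sub_cancel_right, ncard_eq_sum_edgeSet _ fun e h ↦ h.edge_mem]
    refine Finset.sum_congr rfl fun e _ ↦ ?_
    have h : H.IsNonloopAt e x ↔ (x = a e ∧ x ≠ b e) ∨ (x ≠ a e ∧ x = b e) := by
      constructor
      · rintro ⟨z, hz, h⟩
        rcases h.eq_and_eq_or_eq_and_eq (hab e) with ⟨h1, rfl⟩ | ⟨h1, rfl⟩
        · exact Or.inl ⟨Subtype.ext h1, fun h ↦ hz (congrArg _ h.symm)⟩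
        · exact Or.inr ⟨fun h ↦ hz (congrArg _ h.symm), Subtype.ext h1⟩
      · rintro (⟨rfl, h⟩ | ⟨h, rfl⟩)
        · exact ⟨b e, fun h' ↦ h (Subtype.ext h'.symm), hab e⟩
        · exact ⟨a e, fun h' ↦ h (Subtype.ext h'.symm), (hab e).symm⟩
    by_cases h1 : x = a e <;> by_cases h2 : x = b e <;> grind
  · rw [Matrix.diagonal_apply_ne _ hxy, if_neg hxy, ncard_eq_sum_edgeSet _ fun e h ↦ h.edge_mem,
      zero_sub, ← Finset.sum_neg_distrib]
    refine Finset.sum_congr rfl fun e _ ↦ ?_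
    have h : H.IsLink e x y ↔ (x = a e ∧ y = b e) ∨ (x = b e ∧ y = a e) := by
      rw [(hab e).isLink_iff]
      simp only [← Subtype.ext_iff]
      grind
    by_cases h1 : x = a e <;> by_cases h2 : y = b e <;> by_cases h3 : x = b e <;>
      by_cases h4 : y = a e <;> grind

end Incidence

/-! ### Maximal minors of the reduced incidence matrix -/

section Determinant

variable {α β : Type*} {H : Graph α β}

/-- The inclusion of the edges of `H.addCone`. -/
def coneEdge (H : Graph α β) : E(H) ⊕ V(H) → β ⊕ α := Sum.map Subtype.val Subtype.val

theorem coneEdge_injective : Function.Injective H.coneEdge :=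
  Sum.map_injective.2 ⟨Subtype.val_injective, Subtype.val_injective⟩

theorem range_coneEdge : Set.range H.coneEdge = E(H.addCone) := by
  rw [edgeSet_addCone]
  ext (e | P) <;> simp [coneEdge]

variable [DecidableEq V(H)] [Fintype V(H)] {a b : E(H) → V(H)} {g : V(H) → E(H) ⊕ V(H)}

/-- No prime `p` divides the minor: modulo `p`, a left null vector is constant along the chosen
edges of `H` and zero at the chosen cone edges, so connectedness to the cone point makes it vanish.
-/
theorem isUnit_det_coneIncMatrix (hab : ∀ e : E(H), H.IsLink e (a e) (b e))
    (hg : (H.addCone.restrict (H.coneEdge '' Set.range g)).Preconn) :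
    IsUnit ((coneIncMatrix a b).submatrix id g).det := by
  rw [Int.isUnit_iff_natAbs_eq, Nat.eq_one_iff_not_exists_prime_dvd]
  intro p hp hdvd
  have := Fact.mk hp
  have h0 : (((coneIncMatrix a b).submatrix id g).map (Int.castRingHom (ZMod p))).det = 0 := by
    rw [← RingHom.mapMatrix_apply, ← RingHom.map_det]
    exact (ZMod.intCast_zmod_eq_zero_iff_dvd _ _).2 (Int.natCast_dvd.2 hdvd)
  obtain ⟨v, hv, hv0⟩ := Matrix.exists_vecMul_eq_zero_iff.2 h0
  apply hv
  have hcol (j : V(H)) := congrFun hv0 j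
  simp only [Matrix.vecMul, dotProduct, Matrix.map_apply, Matrix.submatrix_apply, id_eq,
    Pi.zero_apply] at hcol
  -- The zero set of `v` extended by `0` to the cone point, which therefore lies in `A` vacuously.
  set A : Set (Option α) := {x | ∀ y : V(H), x = some y.1 → v y = 0} with hA
  ext x
  refine mem_iff_of_reflTransGen (A := A) ?_ (hg none (Or.inl rfl) (some x) (Or.inr ⟨x, x.2, rfl⟩))
    (by simp [hA]) x rfl
  rintro y z ⟨_, hf⟩ hy
  rw [restrict_isLink] at hf
  obtain ⟨⟨_, ⟨j, rfl⟩, rfl⟩, hf⟩ := hf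
  have hj := hcol j
  rcases hgj : g j with e | P
  · simp only [coneIncMatrix, orientedIncMatrix, hgj, Matrix.fromCols_apply_inl, Matrix.of_apply,
      map_sub, apply_ite (Int.castRingHom (ZMod p)), map_one, map_zero, mul_sub, mul_ite, mul_one,
      mul_zero, Finset.sum_sub_distrib, Finset.sum_ite_eq', Finset.mem_univ, if_true,
      sub_eq_zero] at hj
    rw [hgj, coneEdge, Sum.map_inl, addCone_isLink_inl] at hf
    obtain ⟨s, t, hst, rfl, rfl⟩ := hf
    rintro ⟨w, hw⟩ h
    obtain rfl := Option.some.inj h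
    rcases hst.eq_and_eq_or_eq_and_eq (hab e) with ⟨rfl, rfl⟩ | ⟨rfl, rfl⟩
    · exact hj.symm.trans (hy (a e) rfl)
    · exact hj.trans (hy (b e) rfl)
  · simp only [coneIncMatrix, hgj, Matrix.fromCols_apply_inr, Matrix.one_apply,
      apply_ite (Int.castRingHom (ZMod p)), map_one, map_zero, mul_ite, mul_one,
      mul_zero, Finset.sum_ite_eq', Finset.mem_univ, if_true] at hj
    rw [hgj, coneEdge, Sum.map_inr, addCone_isLink_inr] at hf
    rintro w rfl
    obtain ⟨-, ⟨-, h⟩ | ⟨-, h⟩⟩ := hf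
    · simp at h
    · rw [← hj]
      congr 1
      exact Subtype.ext (Option.some.inj h)

theorem det_coneIncMatrix_eq_zero (hab : ∀ e : E(H), H.IsLink e (a e) (b e))
    (hg : ¬ (H.addCone.restrict (H.coneEdge '' Set.range g)).Preconn) :
    ((coneIncMatrix a b).submatrix id g).det = 0 := by
  classical
  set T := H.addCone.restrict (H.coneEdge '' Set.range g) with hT
  obtain ⟨x, hx, hxn⟩ : ∃ x ∈ V(T), ¬ Relation.ReflTransGen T.Adj x none := by
    by_contra! h
    exact hg fun x hx y hy ↦ (h x hx).trans (reflTransGen_adj_symm (h y hy))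
  obtain ⟨x, hxH, rfl⟩ : ∃ y ∈ V(H), some y = x := by
    rcases hx with rfl | hx
    · exact absurd Relation.ReflTransGen.refl hxn
    · exact hx
  -- The indicator of the vertices cut off from the cone point is a nonzero left null vector.
  let v (y : V(H)) : ℤ := if Relation.ReflTransGen T.Adj (some y.1) none then 0 else 1
  refine Matrix.exists_vecMul_eq_zero_iff.1 ⟨v, fun h ↦ ?_, ?_⟩
  · simpa [v, hxn] using congrFun h ⟨x, hxH⟩
  · ext j
    simp only [Matrix.vecMul, dotProduct, Matrix.submatrix_apply, id_eq, Pi.zero_apply]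
    have hmem : H.coneEdge (g j) ∈ H.coneEdge '' Set.range g := ⟨_, ⟨j, rfl⟩, rfl⟩
    rcases hgj : g j with e | P
    · simp only [coneIncMatrix, orientedIncMatrix, Matrix.fromCols_apply_inl, Matrix.of_apply,
        mul_sub, mul_ite, mul_one, mul_zero, Finset.sum_sub_distrib, Finset.sum_ite_eq',
        Finset.mem_univ, if_true, sub_eq_zero]
      have hadj : T.Adj (some (a e).1) (some (b e).1) := by
        refine ⟨.inl e, ?_⟩
        rw [hT, restrict_isLink, addCone_isLink_inl_some]
        exact ⟨by simpa [hgj, coneEdge] using hmem, hab e⟩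
      have : Relation.ReflTransGen T.Adj (some (a e).1) none ↔
          Relation.ReflTransGen T.Adj (some (b e).1) none :=
        ⟨fun h ↦ h.head hadj.symm, fun h ↦ h.head hadj⟩
      simp only [v, this]
    · simp only [coneIncMatrix, Matrix.fromCols_apply_inr, Matrix.one_apply, mul_ite, mul_one,
        mul_zero, Finset.sum_ite_eq', Finset.mem_univ, if_true]
      refine if_pos (Relation.ReflTransGen.single ⟨.inr P, ?_⟩)
      rw [hT, restrict_isLink, addCone_isLink_inr]
      exact ⟨by simpa [hgj, coneEdge] using hmem, P.2, by simp⟩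

open Classical in
theorem sq_det_coneIncMatrix (hab : ∀ e : E(H), H.IsLink e (a e) (b e)) :
    ((coneIncMatrix a b).submatrix id g).det ^ 2 =
      if (H.addCone.restrict (H.coneEdge '' Set.range g)).Preconn then 1 else 0 := by
  split_ifs with h
  · exact Int.isUnit_sq (isUnit_det_coneIncMatrix hab h)
  · rw [det_coneIncMatrix_eq_zero hab h, zero_pow two_ne_zero]

end Determinant

/-! ### Expansion of the characteristic polynomial -/

section Charpoly

open Polynomial

variable {α β : Type*} {H : Graph α β} [DecidableEq V(H)] [Fintype V(H)] [Fintype E(H)]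

/-- Only the left factor carries the weights, so each Cauchy-Binet term is a product of weights
times the square of one integer minor. -/
theorem charmatrix_laplacian (a b : E(H) → V(H)) (hab : ∀ e : E(H), H.IsLink e (a e) (b e)) :
    H.laplacian.charmatrix =
      (Matrix.of fun x s ↦ Sum.elim (fun _ ↦ -1) (fun _ ↦ X) s * C (coneIncMatrix a b x s) :
          Matrix V(H) (E(H) ⊕ V(H)) ℤ[X]) *
        (Matrix.of fun s x ↦ C (coneIncMatrix a b x s) : Matrix (E(H) ⊕ V(H)) V(H) ℤ[X]) := by
  rw [laplacian_eq_mul_transpose a b hab]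
  ext1 x y
  simp only [Matrix.charmatrix_apply, Matrix.mul_apply, Matrix.of_apply,
    Matrix.transpose_apply, Fintype.sum_sum_type, Sum.elim_inl, Sum.elim_inr, coneIncMatrix,
    Matrix.fromCols_apply_inl, Matrix.fromCols_apply_inr, map_sum, map_mul]
  rw [sub_eq_add_neg, add_comm, ← Finset.sum_neg_distrib]
  congr 1
  · exact Finset.sum_congr rfl fun e _ ↦ by ring
  · rw [Finset.sum_eq_single x]
    · simp [Matrix.one_apply, Matrix.diagonal_apply, eq_comm]
    · intro z _ hz
      simp [Matrix.one_apply, hz.symm]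
    · simp

open Classical in
theorem charpoly_laplacian : H.laplacian.charpoly =
    ∑ S ∈ Finset.powersetCard (Fintype.card V(H)) (Finset.univ : Finset (E(H) ⊕ V(H))),
      if (H.addCone.restrict (H.coneEdge '' S)).Preconn
        then (-1) ^ S.toLeft.card * (X : ℤ[X]) ^ S.toRight.card else 0 := by
  choose a b hab using fun e : E(H) ↦ exists_isLink_of_mem_edgeSet e.2
  lift a to E(H) → V(H) using fun e ↦ (hab e).left_mem
  lift b to E(H) → V(H) using fun e ↦ (hab e).right_mem
  have hex (S : Finset (E(H) ⊕ V(H))) : ∃ g : V(H) → E(H) ⊕ V(H),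
      S ∈ Finset.powersetCard (Fintype.card V(H)) Finset.univ →
        Function.Injective g ∧ Finset.univ.image g = S := by
    by_cases hS : S ∈ Finset.powersetCard (Fintype.card V(H)) Finset.univ
    · rw [Finset.mem_powersetCard_univ] at hS
      let i : V(H) ≃ S := Fintype.equivOfCardEq (by simp [hS])
      refine ⟨fun x ↦ i x, fun _ ↦ ⟨Subtype.val_injective.comp i.injective, ?_⟩⟩
      ext s
      simp only [Finset.mem_image, Finset.mem_univ, true_and]
      exact ⟨fun ⟨x, hx⟩ ↦ hx ▸ (i x).2, fun hs ↦ ⟨i.symm ⟨s, hs⟩, by simp⟩⟩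
    -- An arbitrary value: sets of the wrong size do not occur in the sum.
    · refine ⟨fun x ↦ .inr x, fun h ↦ absurd h hS⟩
  choose g hg using hex
  rw [Matrix.charpoly, charmatrix_laplacian a b hab, Matrix.det_mul_eq_sum_powersetCard _ _ g
    (fun S hS ↦ (hg S hS).1) (fun S hS ↦ by convert (hg S hS).2)]
  refine Finset.sum_congr rfl fun S hS ↦ ?_
  obtain ⟨hinj, himg⟩ := hg S hS
  have hrange : Set.range (g S) = S := by
    rw [← Set.image_univ, ← Finset.coe_univ, ← Finset.coe_image, himg]
  set w : E(H) ⊕ V(H) → ℤ[X] := Sum.elim (fun _ ↦ -1) fun _ ↦ X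
  have h1 : ((Matrix.of fun x s ↦ w s * C (coneIncMatrix a b x s)).submatrix id (g S)).det =
      (∏ x, w (g S x)) * C ((coneIncMatrix a b).submatrix id (g S)).det := by
    rw [RingHom.map_det, ← Matrix.det_mul_row]
    rfl
  have h2 : ((Matrix.of fun s x ↦ C (coneIncMatrix a b x s)).submatrix (g S) id).det =
      C ((coneIncMatrix a b).submatrix id (g S)).det := by
    rw [RingHom.map_det, ← Matrix.det_transpose]
    rfl
  have h3 : ∏ x, w (g S x) = (-1) ^ S.toLeft.card * (X : ℤ[X]) ^ S.toRight.card := by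
    calc ∏ x, w (g S x) = ∏ s ∈ Finset.univ.image (g S), w s :=
          (Finset.prod_image hinj.injOn).symm
      _ = ∏ s ∈ S.toLeft.disjSum S.toRight, w s := by
          rw [himg, Finset.toLeft_disjSum_toRight]
      _ = _ := by simp [Finset.prod_disjSum, w]
  rw [h1, h2, h3, mul_assoc, ← C_mul, ← sq, sq_det_coneIncMatrix hab, hrange]
  split_ifs <;> simp

open Classical in
theorem coeff_charpoly_laplacian {j : ℕ} (hj : j ≤ Fintype.card V(H)) :
    H.laplacian.charpoly.coeff (Fintype.card V(H) - j) = (-1) ^ j *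
      (({S : Finset (E(H) ⊕ V(H)) | S.card = Fintype.card V(H) ∧
        (H.addCone.restrict (H.coneEdge '' S)).Preconn ∧ S.toLeft.card = j}.ncard : ℕ) : ℤ) := by
  have hset : {S : Finset (E(H) ⊕ V(H)) | S.card = Fintype.card V(H) ∧
        (H.addCone.restrict (H.coneEdge '' S)).Preconn ∧ S.toLeft.card = j} =
      ({S ∈ Finset.powersetCard (Fintype.card V(H)) (Finset.univ : Finset (E(H) ⊕ V(H))) |
        (H.addCone.restrict (H.coneEdge '' S)).Preconn ∧ S.toLeft.card = j} :
          Finset (Finset (E(H) ⊕ V(H)))) := by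
    ext S
    simp
  rw [hset, Set.ncard_coe_finset, charpoly_laplacian, finsetSum_coeff, mul_comm,
    ← nsmul_eq_mul, ← Finset.sum_const, Finset.sum_filter]
  refine Finset.sum_congr rfl fun S hS ↦ ?_
  rw [Finset.mem_powersetCard_univ] at hS
  have hcard := S.card_toLeft_add_card_toRight
  by_cases hp : (H.addCone.restrict (H.coneEdge '' S)).Preconn
  · have h1 : ((-1 : ℤ[X]) ^ S.toLeft.card) = C ((-1) ^ S.toLeft.card) := by simp
    simp only [hp, if_true, true_and, h1, coeff_C_mul, coeff_X_pow]
    -- As `S` has `n` elements and `j ≤ n`, it has `n - j` cone edges exactly when it has `j` edges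
    -- of `H`.
    by_cases h : S.toLeft.card = j
    · rw [if_pos h, if_pos (by omega), mul_one, h]
    · rw [if_neg h, if_neg (by omega), mul_zero]
  · simp [hp]

end Charpoly

/-! ### Comparison of the counts -/

section Main

variable {α β : Type*} {H : Graph α β}

theorem ncard_edgeSet_restrict_coneEdge (S : Finset (E(H) ⊕ V(H))) :
    E(H.addCone.restrict (H.coneEdge '' S)).ncard = S.card := by
  rw [edgeSet_restrict, Set.inter_eq_right.2, Set.ncard_image_of_injective _ coneEdge_injective,
    Set.ncard_coe_finset]
  rw [← range_coneEdge]
  exact Set.image_subset_range _ _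

theorem numSpanningTrees_addCone (j : ℕ) : numSpanningTrees H.addCone (cone β V(H)) j =
    {S | S ⊆ E(H.addCone) ∧ (H.addCone.restrict S).IsTree ∧
      (S ∩ Sum.inl '' E(H)).ncard = j}.ncard := by
  rw [numSpanningTrees, edgeSet_addCone_sdiff]
  exact ncard_isSpanningTree fun S ↦ (S ∩ Sum.inl '' E(H)).ncard = j

variable [Fintype V(H)]

theorem ncard_vertexSet_addCone : V(H.addCone).ncard = Fintype.card V(H) + 1 := by
  rw [vertexSet_addCone, Set.ncard_insert_of_notMem (by simp)
    ((Set.toFinite V(H)).image some), Set.ncard_image_of_injective _ (Option.some_injective _),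
    ← Nat.card_eq_fintype_card]
  rfl

variable [Fintype E(H)]

theorem finite_edgeSet_addCone : E(H.addCone).Finite := by
  rw [← range_coneEdge]
  exact Set.finite_range _

theorem isTree_addCone_restrict_iff {S : Set (β ⊕ α)} : (H.addCone.restrict S).IsTree ↔
    (H.addCone.restrict S).Preconn ∧ E(H.addCone.restrict S).ncard = Fintype.card V(H) := by
  have hV : V(H.addCone.restrict S).Finite := by
    rw [vertexSet_restrict, vertexSet_addCone]
    exact ((Set.toFinite V(H)).image some).insert none
  have hE : E(H.addCone.restrict S).Finite :=
    (finite_edgeSet_addCone (H := H)).subset (restrict_le (G := H.addCone)).edgeSet_mono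
  rw [isTree_iff_preconn_and_ncard hV hE, vertexSet_restrict, ncard_vertexSet_addCone,
    Nat.add_right_cancel_iff, eq_comm (a := Fintype.card _)]

theorem ncard_spanning_edge_sets (j : ℕ) :
    {S : Finset (E(H) ⊕ V(H)) | S.card = Fintype.card V(H) ∧
      (H.addCone.restrict (H.coneEdge '' S)).Preconn ∧ S.toLeft.card = j}.ncard =
    {S | S ⊆ E(H.addCone) ∧ (H.addCone.restrict S).IsTree ∧
      (S ∩ Sum.inl '' E(H)).ncard = j}.ncard := by
  have hleft (S : Finset (E(H) ⊕ V(H))) :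
      (H.coneEdge '' S ∩ Sum.inl '' E(H)).ncard = S.toLeft.card := by
    rw [← Set.ncard_coe_finset, ← Set.ncard_image_of_injective _
      (Sum.inl_injective.comp Subtype.val_injective : Function.Injective
        fun e : E(H) ↦ (Sum.inl e.1 : β ⊕ α))]
    congr 1
    ext (e | P) <;> simp [coneEdge]
  have htree (S : Finset (E(H) ⊕ V(H))) : (H.addCone.restrict (H.coneEdge '' S)).IsTree ↔
      (H.addCone.restrict (H.coneEdge '' S)).Preconn ∧ S.card = Fintype.card V(H) := by
    rw [isTree_addCone_restrict_iff, ncard_edgeSet_restrict_coneEdge]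
  refine Set.ncard_congr (fun S _ ↦ H.coneEdge '' S) ?_ ?_ ?_
  · rintro S ⟨h1, h2, h3⟩
    refine ⟨?_, (htree S).2 ⟨h2, h1⟩, (hleft S).trans h3⟩
    rw [← range_coneEdge]
    exact Set.image_subset_range _ _
  · rintro S S' - - h
    exact Finset.coe_injective (coneEdge_injective.image_injective h)
  · rintro S ⟨hS, hT, hj⟩
    rw [← range_coneEdge, Set.subset_range_iff_exists_image_eq] at hS
    obtain ⟨S, rfl⟩ := hS
    lift S to Finset (E(H) ⊕ V(H)) using Set.toFinite S
    exact ⟨S, ⟨((htree S).1 hT).2, ((htree S).1 hT).1, (hleft S).symm.trans hj⟩, rfl⟩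

/-- A spanning tree of the cone graph has `n` edges, so fixing its number of edges in `H`, of cone
edges, or of roots amounts to the same thing. -/
theorem ncard_inl_add_ncard_inr {S : Set (β ⊕ α)} (hS : S ⊆ E(H.addCone))
    (hT : (H.addCone.restrict S).IsTree) :
    (S ∩ Sum.inl '' E(H)).ncard + (S ∩ Sum.inr '' V(H)).ncard = Fintype.card V(H) ∧
      (Sum.inr ⁻¹' S).ncard = (S ∩ Sum.inr '' V(H)).ncard := by
  have hfin : S.Finite := finite_edgeSet_addCone.subset hS
  constructor
  · have := (isTree_addCone_restrict_iff.1 hT).2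
    rw [edgeSet_restrict, Set.inter_eq_right.2 hS] at this
    rw [← this, ← Set.ncard_union_eq _ (hfin.subset Set.inter_subset_left)
      (hfin.subset Set.inter_subset_left), ← Set.inter_union_distrib_left, ← edgeSet_addCone,
      Set.inter_eq_left.2 hS]
    refine Set.disjoint_left.2 ?_
    rintro _ ⟨-, e, -, rfl⟩ ⟨-, P, -, h⟩
    cases h
  · rw [← Set.ncard_image_of_injective _ (Sum.inr_injective (α := β))]
    congr 1
    rw [edgeSet_addCone] at hS
    ext (e | P)
    · simp
    · have := @hS (.inr P)
      simp at this ⊢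
      tauto

theorem numSpanningTrees_addCone_eq_ncard_cone {j : ℕ} (hj : j ≤ Fintype.card V(H)) :
    numSpanningTrees H.addCone (cone β V(H)) j = {T | H.addCone.IsSpanningTree T ∧
      (E(T) ∩ E(cone β V(H))).ncard = Fintype.card V(H) - j}.ncard := by
  rw [numSpanningTrees_addCone, ncard_isSpanningTree
    fun S ↦ (S ∩ E(cone β V(H))).ncard = Fintype.card V(H) - j, edgeSet_cone]
  congr 1
  ext S
  refine and_congr_right fun hS ↦ and_congr_right fun hT ↦ ?_
  have := (ncard_inl_add_ncard_inr hS hT).1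
  omega

theorem numSpanningTrees_addCone_eq_numRootedSpanningForests {j : ℕ}
    (hj : j ≤ Fintype.card V(H)) : numSpanningTrees H.addCone (cone β V(H)) j =
      H.numRootedSpanningForests (Fintype.card V(H) - j) := by
  rw [numSpanningTrees_addCone, numRootedSpanningForests_eq]
  congr 1
  ext S
  refine and_congr_right fun hS ↦ and_congr_right fun hT ↦ ?_
  have := ncard_inl_add_ncard_inr hS hT
  omega

/-- Any vertex has a root in its component, so at least one of the `n` tree edges is a cone edge. -/
theorem numSpanningTrees_addCone_card (hV : V(H).Nonempty) :
    numSpanningTrees H.addCone (cone β V(H)) (Fintype.card V(H)) = 0 := by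
  rw [numSpanningTrees_addCone]
  refine (congrArg Set.ncard (Set.eq_empty_of_forall_notMem ?_)).trans (Set.ncard_empty _)
  rintro S ⟨hS, hT, hj⟩
  have h := ncard_inl_add_ncard_inr hS hT
  obtain ⟨u, hu⟩ := hV
  obtain ⟨r, -, hr⟩ := (existsUnique_root_of_isTree hT _ ⟨u, hu, rfl⟩).exists
  have h0 : (Sum.inr ⁻¹' S : Set α) = ∅ := by
    rw [← Set.ncard_eq_zero ((finite_edgeSet_addCone.subset hS).preimage Sum.inr_injective.injOn)]
    omega
  exact Set.notMem_empty r (h0 ▸ hr)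

theorem coeff_charpoly_eq_numSpanningTrees [DecidableEq V(H)] {j : ℕ}
    (hj : j ≤ Fintype.card V(H)) : H.laplacian.charpoly.coeff (Fintype.card V(H) - j) =
      (-1) ^ j * ((numSpanningTrees H.addCone (cone β V(H)) j : ℕ) : ℤ) := by
  rw [coeff_charpoly_laplacian hj, ncard_spanning_edge_sets, numSpanningTrees_addCone]

end Main

end Graph

theorem theorem5p2 {α β : Type*} (H : Graph α β) [Fintype V(H)] [DecidableEq V(H)]
    [Finite E(H)] :
    (Graph.laplacian H).charpoly =
        Polynomial.X ^ Fintype.card V(H) +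
          ∑ j ∈ Finset.Icc 1 (Fintype.card V(H) - 1),
            (-1) ^ j *
              Polynomial.C ((Graph.numSpanningTrees H.addCone (Graph.cone β V(H)) j : ℕ) : ℤ) *
              Polynomial.X ^ (Fintype.card V(H) - j) ∧
      ∀ j ≤ Fintype.card V(H),
        (Graph.laplacian H).charpoly.coeff (Fintype.card V(H) - j) =
            (-1) ^ j * ((Graph.numSpanningTrees H.addCone (Graph.cone β V(H)) j : ℕ) : ℤ) ∧
        Graph.numSpanningTrees H.addCone (Graph.cone β V(H)) j =
            {T | H.addCone.IsSpanningTree T ∧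
              (E(T) ∩ E(Graph.cone β V(H))).ncard = Fintype.card V(H) - j}.ncard ∧
        Graph.numSpanningTrees H.addCone (Graph.cone β V(H)) j =
            {T | H.addCone.IsSpanningTree T ∧ (E(T) ∩ Sum.inl '' E(H)).ncard = j}.ncard ∧
        Graph.numSpanningTrees H.addCone (Graph.cone β V(H)) j =
            Graph.numRootedSpanningForests H (Fintype.card V(H) - j) := by
  classical
  have := Fintype.ofFinite E(H)
  refine ⟨?_, fun j hj ↦ ⟨Graph.coeff_charpoly_eq_numSpanningTrees hj,
    Graph.numSpanningTrees_addCone_eq_ncard_cone hj, ?_,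
    Graph.numSpanningTrees_addCone_eq_numRootedSpanningForests hj⟩⟩
  · set n := Fintype.card V(H) with hn
    set b : ℕ → ℕ := Graph.numSpanningTrees H.addCone (Graph.cone β V(H)) with hb
    have hdeg : H.laplacian.charpoly.natDegree = n := Matrix.charpoly_natDegree_eq_dim _
    have hmonic : H.laplacian.charpoly.coeff n = 1 := by
      rw [← hdeg]
      exact Matrix.charpoly_monic _
    have hterm (j : ℕ) : ((-1) ^ j * Polynomial.C (b j : ℤ) * Polynomial.X ^ (n - j) :
        Polynomial ℤ) = Polynomial.C ((-1) ^ j * (b j : ℤ)) * Polynomial.X ^ (n - j) := by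
      simp
    have hsum : H.laplacian.charpoly = ∑ j ∈ Finset.range (n + 1),
        Polynomial.C (H.laplacian.charpoly.coeff (n - j)) * Polynomial.X ^ (n - j) := by
      conv_lhs => rw [Polynomial.as_sum_range_C_mul_X_pow H.laplacian.charpoly, hdeg,
        ← Finset.sum_range_reflect]
      simp
    -- For `n = 0` the constant coefficient is the leading one, not `0`; the sum over `Icc 1 (0 -
    -- 1)` is empty and both sides are `1`.
    rcases Nat.eq_zero_or_pos n with h0 | hpos
    · rw [hsum, h0]
      simpa [h0] using congrArg Polynomial.C hmonic
    · have hV : V(H).Nonempty := by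
        exact Set.nonempty_coe_sort.1 (Fintype.card_pos_iff.1 hpos)
      have hlast : H.laplacian.charpoly.coeff 0 = 0 := by
        have := Graph.coeff_charpoly_eq_numSpanningTrees (H := H) le_rfl
        rwa [Graph.numSpanningTrees_addCone_card hV, Nat.sub_self, Nat.cast_zero, mul_zero] at this
      rw [hsum, Finset.sum_range_succ, Nat.sub_self, hlast, Polynomial.C_0, zero_mul, add_zero]
      obtain ⟨m, hm⟩ : ∃ m, n = m + 1 := ⟨n - 1, by omega⟩
      rw [Finset.range_eq_Ico, Finset.sum_eq_sum_Ico_succ_bot hpos, Nat.sub_zero, hmonic,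
        Polynomial.C_1, one_mul]
      congr 1
      refine Finset.sum_congr ?_ fun j hj ↦ ?_
      · ext j
        simp only [Finset.mem_Ico, Finset.mem_Icc]
        omega
      · rw [hterm, Graph.coeff_charpoly_eq_numSpanningTrees]
        simp only [Finset.mem_Icc] at hj
        omega
  · rw [Graph.numSpanningTrees, Graph.edgeSet_addCone_sdiff]
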